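/- Let $u^+,\nu^-,k,f,\omega,d,D>0$ be constants (with $f=f_+^-$), and for $U=(p^+,p^-,c)\in\mathbb R^3$ set $$ A(U)=\begin{pmatrix}-u^+c&0&-u^+p^+\\0&\nu^-&0\\0&0&0\end{pmatrix},\quad B(U)=\begin{pmatrix}-f&\omega c&0\\f&-\omega c&0\\-u^+c&\nu^-&-k\end{pmatrix},\quad C=\begin{pmatrix}d&0&0\\0&d&0\\0&0&D\end{pmatrix}. $$ Consider the steady-state ODE $$A(U)U'+B(U)U+CU''=0\qquad (\ast)$$ and the curve of its physical equilibria $$ \mathcal E=\Big\{\Big(\tfrac{\omega kc^2}{\nu^-f-u^+\omega c^2},\ \tfrac{kcf}{\nu^-f-u^+\omega c^2},\ c\Big)\ :\ c\ge 0,\ \ \nu^-f-u^+\omega c^2>0\Big\}\subset\mathbb R^3 . $$ Then for all $U_+\in\mathcal E$ outside a set of one-dimensional (Hausdorff) measure zero, all orbits of $(\ast)$ converging to $U_+$ do so at uniform exponential rate: there is $\theta>0$ (depending only on the constants and on $U_+$) such that for every solution $U$ of $(\ast)$ on $[0,\infty)$ with $\lim_{x\to+\infty}U(x)=U_+$ there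 is $K$ with $$|U(x)-U_+|+|U'(x)|\le K e^{-\theta x}\qquad\text{for all }x\ge 0 .$$ -/

import Mathlib

open Matrix

/-- The positive constants of the model. -/
structure MTParams where
  /-- growth velocity coefficient `u⁺` (so that `v⁺ = u⁺ c`) -/
  u : ℝ
  /-- shrinking velocity `v⁻` -/
  v : ℝ
  /-- nucleation rate -/
  k : ℝ
  /-- catastrophe frequency `f₊⁻` -/
  f : ℝ
  /-- rescue coefficient `ω` (so that `f₋⁺ = ω c`) -/
  w : ℝ
  /-- diffusion constant of the microtubule densities -/
  d : ℝ
  /-- diffusion constant of the free tubulin -/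
  D : ℝ
  u_pos : 0 < u
  v_pos : 0 < v
  k_pos : 0 < k
  f_pos : 0 < f
  w_pos : 0 < w
  d_pos : 0 < d
  D_pos : 0 < D

/-- States `U = (p⁺, p⁻, c)`, with coordinates indexed by `0, 1, 2`. -/
abbrev MTState : Type := EuclideanSpace ℝ (Fin 3)

namespace MTParams

/-- Convection matrix `A(U)`. -/
def A (π : MTParams) (U : MTState) : Matrix (Fin 3) (Fin 3) ℝ :=
  !![-(π.u * U 2), 0, -(π.u * U 0);
     0, π.v, 0;
     0, 0, 0]

/-- Reaction matrix `B(U)`. -/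
def B (π : MTParams) (U : MTState) : Matrix (Fin 3) (Fin 3) ℝ :=
  !![-π.f, π.w * U 2, 0;
     π.f, -(π.w * U 2), 0;
     -(π.u * U 2), π.v, -π.k]

/-- Diffusion matrix `C`. -/
def C (π : MTParams) : Matrix (Fin 3) (Fin 3) ℝ :=
  !![π.d, 0, 0;
     0, π.d, 0;
     0, 0, π.D]

/-- `(U, P)` is an orbit on `[0, ∞)` of the steady-state equation
`A(U) U' + B(U) U + C U'' = 0`, with `P = U'`. -/
def IsSteadyOrbit (π : MTParams) (U P : ℝ → MTState) : Prop :=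
  ∀ x : ℝ, 0 ≤ x →
    HasDerivWithinAt U (P x) (Set.Ici 0) x ∧
    ∃ Q : MTState, HasDerivWithinAt P Q (Set.Ici 0) x ∧
      π.A (U x) *ᵥ (P x).ofLp + π.B (U x) *ᵥ (U x).ofLp + π.C *ᵥ Q.ofLp = 0

/-- The curve of physical equilibria, parametrized by the concentration `c ≥ 0`
subject to the physicality condition `v⁻ f₊⁻ - u⁺ ω c² > 0`. -/
def equilibriumCurve (π : MTParams) : Set MTState :=
  {U | ∃ c : ℝ, 0 ≤ c ∧ 0 < π.v * π.f - π.u * π.w * c ^ 2 ∧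
    U = !₂[π.w * π.k * c ^ 2 / (π.v * π.f - π.u * π.w * c ^ 2),
           π.k * c * π.f / (π.v * π.f - π.u * π.w * c ^ 2),
           c]}

/-- All orbits converging to `Uplus` do so at a uniform exponential rate: the rate `θ` is common
to all these orbits, and the decay is that of the orbit `(U, U')` in phase space. -/
def UniformExponentialConvergence (π : MTParams) (Uplus : MTState) : Prop :=
  ∃ θ : ℝ, 0 < θ ∧ ∀ U P : ℝ → MTState, π.IsSteadyOrbit U P →
    Filter.Tendsto U Filter.atTop (nhds Uplus) →
    ∃ K : ℝ, ∀ x : ℝ, 0 ≤ x → ‖U x - Uplus‖ + ‖P x‖ ≤ K * Real.exp (-θ * x)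

end MTParams

/-!
The sum of the first two equations is an exact derivative, so the total flux
`d (p⁺ + p⁻)' - u c p⁺ + v p⁻` is constant along orbits, and an orbit that converges to an
equilibrium `(p, q, c)` has the flux of this equilibrium (`MTParams.IsSteadyOrbit.flux_eq`, which
uses that `U'` tends to zero, `MTParams.IsSteadyOrbit.tendsto_deriv`). At an equilibrium the flux is
`k c`, so it varies along the curve of equilibria, and on a level set of the flux the phase space
has dimension five with no zero eigenvalue left: there the equation reads `z' = M z + N(z)`, with
`M = MTParams.linMatrix` invertible and `N` quadratic.

Suppose that no two eigenvalues of `M` have sum zero. Then the Lyapunov equation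
`H M + Mᵀ H = 1` has a solution (`Matrix.exists_lyapunov_of_isCoprime_charpoly`), so the quadratic
form of `H` grows along the linear flow at rate `‖z‖²`. This alone forces all orbits that converge
to the equilibrium to do so at a common exponential rate
(`exists_uniform_exp_decay_of_lyapunov`).

The condition on the eigenvalues says that the characteristic polynomial `χ` satisfies
`χ(0) ≠ 0`, which holds on the whole curve, and that the even and odd parts of `χ` have nonzero
resultant. Along the curve and up to nonvanishing factors this resultant is a polynomial in
`t = 1 / c`, which is nonzero at `t = 0`; so it has finitely many zeros
(`MTParams.finite_scaledResultant_eq_zero`). The exceptional equilibria are among the finitely many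
given by these zeros together with `c = 0`.
-/

open Filter Set Polynomial
open scoped Topology RealInnerProductSpace

/-! ### Decay of solutions -/

/-- A quadratic form `V z = ⟪H z, z⟫` that grows at unit rate, `V' = ‖z‖²`, along the linear flow
`z' = L z` forces every solution of a quadratic perturbation that converges to `0` to do so at an
exponential rate depending only on `L`, `H` and `C`. Neither invariant subspaces nor a stable
manifold enter: `V` is eventually increasing along the solution and tends to `0`, hence is
nonpositive, and then `ε ‖z‖² - V` for a small `ε` is a Lyapunov function that is bounded below
by `ε ‖z‖²` along this solution. -/
theorem exists_uniform_exp_decay_of_lyapunov {F : Type*} [NormedAddCommGroup F]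
    [InnerProductSpace ℝ F] (L H : F →L[ℝ] F)
    (hH : ∀ z, ⟪H (L z), z⟫ + ⟪H z, L z⟫ = ‖z‖ ^ 2) {C : ℝ} (hC : 0 ≤ C) :
    ∃ θ : ℝ, 0 < θ ∧ ∀ z N : ℝ → F,
      (∀ x, 0 ≤ x → HasDerivWithinAt z (L (z x) + N x) (Ici 0) x) →
      (∀ x, 0 ≤ x → ‖N x‖ ≤ C * ‖z x‖ ^ 2) →
      Tendsto z atTop (𝓝 0) →
      ∃ K : ℝ, ∀ x, 0 ≤ x → ‖z x‖ ≤ K * Real.exp (-θ * x) := by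
  set h := ‖H‖ with hh
  set l := ‖L‖ with hl
  have h0 : 0 ≤ h := norm_nonneg _
  have l0 : 0 ≤ l := norm_nonneg _
  -- In the ball of radius `ρ` the perturbation takes away at most half of `V' = ‖z‖²`, and the
  -- choice of `ε` keeps `ε (‖z‖²)'` below a quarter of `‖z‖²`.
  obtain ⟨ρ, hρ0, hρ1, hρ⟩ : ∃ ρ : ℝ, 0 < ρ ∧ ρ ≤ 1 ∧ 2 * h * C * ρ ≤ 1 / 2 := by
    refine ⟨1 / (4 * (h * C) + 1), by positivity, ?_, ?_⟩
    · rw [div_le_one (by positivity)]; nlinarith [mul_nonneg h0 hC]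
    · rw [mul_one_div, div_le_iff₀ (by positivity)]; nlinarith [mul_nonneg h0 hC]
  obtain ⟨ε, hε0, hε⟩ : ∃ ε : ℝ, 0 < ε ∧ 2 * ε * (l + C) ≤ 1 / 4 := by
    refine ⟨1 / (8 * (l + C) + 1), by positivity, ?_⟩
    rw [mul_one_div, div_mul_eq_mul_div, div_le_iff₀ (by positivity)]; linarith
  -- The constants give `(ε ‖z‖² - V)' ≤ -‖z‖² / 4 ≤ -2 θ (ε ‖z‖² - V)`.
  set θ := 1 / (8 * (h + ε)) with hθ
  have hθ0 : 0 < θ := by positivity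
  have hθe : 2 * θ * (h + ε) = 1 / 4 := by rw [hθ]; field_simp; norm_num
  refine ⟨θ, hθ0, fun z N hz hN hlim => ?_⟩
  have hcont : ContinuousOn z (Ici 0) := fun x hx => (hz x hx).continuousWithinAt
  obtain ⟨T, hT0, hT⟩ : ∃ T : ℝ, 0 ≤ T ∧ ∀ x, T ≤ x → ‖z x‖ ≤ ρ := by
    have h1 : ∀ᶠ x in atTop, ‖z x‖ ≤ ρ := by
      have := hlim.norm
      rw [norm_zero] at this
      exact this.eventually_le_const hρ0
    obtain ⟨T, hT⟩ := eventually_atTop.1 h1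
    exact ⟨max T 0, le_max_right _ _, fun x hx => hT x ((le_max_left _ _).trans hx)⟩
  have hTsub : Ici T ⊆ Ici (0 : ℝ) := Ici_subset_Ici.2 hT0
  have hd : ∀ x, T < x → HasDerivAt z (L (z x) + N x) x := fun x hx =>
    (hz x (hT0.trans hx.le)).hasDerivAt (Ici_mem_nhds (hT0.trans_lt hx))
  have hNs : ∀ x, T ≤ x → ‖N x‖ ≤ C * ρ * ‖z x‖ := fun x hx => by
    have := hN x (hT0.trans hx)
    nlinarith [mul_le_mul_of_nonneg_left
      (mul_le_mul_of_nonneg_right (hT x hx) (norm_nonneg (z x))) hC]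
  set V : ℝ → ℝ := fun x => ⟪H (z x), z x⟫ with hV
  set W : ℝ → ℝ := fun x => ⟪z x, z x⟫ with hW
  have hWn : ∀ x, W x = ‖z x‖ ^ 2 := fun x => real_inner_self_eq_norm_sq _
  have hVb : ∀ x, |V x| ≤ h * ‖z x‖ ^ 2 := fun x => by
    calc |V x| ≤ ‖H (z x)‖ * ‖z x‖ := abs_real_inner_le_norm _ _
      _ ≤ (h * ‖z x‖) * ‖z x‖ := by gcongr; exact H.le_opNorm _
      _ = _ := by ring
  have hVc : ContinuousOn V (Ici T) :=
    ((H.continuous.comp_continuousOn hcont).inner hcont).mono hTsub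
  have hWc : ContinuousOn W (Ici T) := (hcont.inner hcont).mono hTsub
  have hVd : ∀ x, T < x → ∃ V', HasDerivAt V V' x ∧ ‖z x‖ ^ 2 / 2 ≤ V' := fun x hx => by
    refine ⟨_, (H.hasFDerivAt.comp_hasDerivAt x (hd x hx)).inner ℝ (hd x hx), ?_⟩
    have e1 : |⟪H (z x), N x⟫| ≤ h * C * ρ * ‖z x‖ ^ 2 := by
      calc _ ≤ ‖H (z x)‖ * ‖N x‖ := abs_real_inner_le_norm _ _
        _ ≤ (h * ‖z x‖) * (C * ρ * ‖z x‖) := by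
          gcongr
          · exact H.le_opNorm _
          · exact hNs x hx.le
        _ = _ := by ring
    have e2 : |⟪H (N x), z x⟫| ≤ h * C * ρ * ‖z x‖ ^ 2 := by
      calc _ ≤ ‖H (N x)‖ * ‖z x‖ := abs_real_inner_le_norm _ _
        _ ≤ (h * (C * ρ * ‖z x‖)) * ‖z x‖ := by
          gcongr
          exact (H.le_opNorm _).trans (mul_le_mul_of_nonneg_left (hNs x hx.le) h0)
        _ = _ := by ring
    have e3 := hH (z x)
    have e4 : 2 * h * C * ρ * ‖z x‖ ^ 2 ≤ 1 / 2 * ‖z x‖ ^ 2 := by gcongr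
    simp only [Function.comp_apply, map_add, inner_add_left, inner_add_right]
    linarith [(abs_le.1 e1).1, (abs_le.1 e2).1]
  have hWd : ∀ x, T < x → ∃ W', HasDerivAt W W' x ∧ W' ≤ 2 * (l + C) * ‖z x‖ ^ 2 := fun x hx => by
    refine ⟨_, (hd x hx).inner ℝ (hd x hx), ?_⟩
    have e1 : ‖L (z x) + N x‖ ≤ (l + C) * ‖z x‖ := by
      have := (norm_add_le (L (z x)) (N x)).trans (add_le_add (L.le_opNorm _) (hNs x hx.le))
      have h2 : C * ρ * ‖z x‖ ≤ C * ‖z x‖ := by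
        gcongr
        exact mul_le_of_le_one_right hC hρ1
      linarith
    have e2 : ⟪z x, L (z x) + N x⟫ ≤ ‖z x‖ * ((l + C) * ‖z x‖) :=
      (real_inner_le_norm _ _).trans (by gcongr)
    rw [real_inner_comm (z x) (L (z x) + N x)]
    linarith
  have hVmono : MonotoneOn V (Ici T) := by
    refine monotoneOn_of_deriv_nonneg (convex_Ici T) hVc ?_ ?_ <;> rw [interior_Ici] <;>
      intro x hx <;> obtain ⟨V', h1, h2⟩ := hVd x hx
    · exact h1.differentiableAt.differentiableWithinAt
    · rw [h1.deriv]; exact le_trans (by positivity) h2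
  have hVlim : Tendsto V atTop (𝓝 0) := by
    have : Tendsto V atTop (𝓝 ⟪H (0 : F), (0 : F)⟫) :=
      ((H.continuous.tendsto _).comp hlim).inner hlim
    simpa using this
  -- `V` increases to its limit `0`, hence is nonpositive along the orbit.
  have hVneg : ∀ x, T ≤ x → V x ≤ 0 := fun x hx =>
    ge_of_tendsto hVlim ((eventually_ge_atTop x).mono fun y hy => hVmono hx (hx.trans hy) hy)
  set G : ℝ → ℝ := fun x => (ε * W x - V x) * Real.exp (2 * θ * x) with hG
  have hGanti : AntitoneOn G (Ici T) := by
    have hGd : ∀ x, T < x → ∃ G', HasDerivAt G G' x ∧ G' ≤ 0 := fun x hx => by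
      obtain ⟨V', hV1, hV2⟩ := hVd x hx
      obtain ⟨W', hW1, hW2⟩ := hWd x hx
      have hexp : HasDerivAt (fun x => Real.exp (2 * θ * x))
          (Real.exp (2 * θ * x) * (2 * θ)) x := by
        simpa using ((hasDerivAt_id x).const_mul (2 * θ)).exp
      refine ⟨_, ((hW1.const_mul ε).sub hV1).mul hexp, ?_⟩
      have k1 : ε * W x - V x ≤ (h + ε) * ‖z x‖ ^ 2 := by
        rw [hWn]; linarith [(abs_le.1 (hVb x)).1]
      have k2 : 2 * θ * (ε * W x - V x) ≤ 1 / 4 * ‖z x‖ ^ 2 := by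
        rw [← hθe, mul_assoc (2 * θ)]; gcongr
      have k3 : ε * W' ≤ 1 / 4 * ‖z x‖ ^ 2 := by
        calc ε * W' ≤ ε * (2 * (l + C) * ‖z x‖ ^ 2) := by gcongr
          _ = (2 * ε * (l + C)) * ‖z x‖ ^ 2 := by ring
          _ ≤ _ := by gcongr
      have k4 : (ε * W' - V') + 2 * θ * (ε * W x - V x) ≤ 0 := by linarith
      have := mul_nonpos_of_nonpos_of_nonneg k4 (Real.exp_pos (2 * θ * x)).le
      simp only [Pi.sub_apply]
      linarith
    refine antitoneOn_of_deriv_nonpos (convex_Ici T) ?_ ?_ ?_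
    · exact ((continuousOn_const.mul hWc).sub hVc).mul (by fun_prop)
    · rw [interior_Ici]; intro x hx; obtain ⟨V', h1, h2⟩ := hGd x hx
      exact h1.differentiableAt.differentiableWithinAt
    · rw [interior_Ici]; intro x hx; obtain ⟨V', h1, h2⟩ := hGd x hx
      rw [h1.deriv]; exact h2
  have hfar : ∀ x, T ≤ x → ‖z x‖ ≤ √(G T / ε) * Real.exp (-θ * x) := fun x hx => by
    have k1 : ε * ‖z x‖ ^ 2 * Real.exp (2 * θ * x) ≤ G T := by
      refine le_trans ?_ (hGanti self_mem_Ici hx hx)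
      simp only [hG]
      gcongr
      rw [hWn]; linarith [hVneg x hx]
    have k2 : ‖z x‖ * Real.exp (θ * x) ≤ √(G T / ε) := by
      apply Real.le_sqrt_of_sq_le
      rw [le_div_iff₀ hε0, mul_pow, ← Real.exp_nat_mul]
      push_cast
      rw [← mul_assoc (2 : ℝ)]
      linarith
    calc ‖z x‖ = ‖z x‖ * Real.exp (θ * x) * Real.exp (-θ * x) := by
          rw [mul_assoc, ← Real.exp_add]; simp
      _ ≤ _ := by gcongr
  -- On `[0, T]` the bound comes from compactness.
  obtain ⟨K₁, hK₁⟩ := isCompact_Icc.exists_bound_of_continuousOn (s := Icc 0 T)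
    (f := fun x => Real.exp (θ * x) • z x)
    (ContinuousOn.smul (by fun_prop) (hcont.mono Icc_subset_Ici_self))
  refine ⟨max K₁ √(G T / ε), fun x hx => ?_⟩
  rcases le_total T x with hxT | hxT
  · refine (hfar x hxT).trans ?_
    gcongr
    exact le_max_right _ _
  · have := hK₁ x ⟨hx, hxT⟩
    rw [norm_smul, Real.norm_eq_abs, Real.abs_exp] at this
    calc ‖z x‖ = Real.exp (θ * x) * ‖z x‖ * Real.exp (-θ * x) := by
          rw [mul_right_comm, ← Real.exp_add]; simp
      _ ≤ K₁ * Real.exp (-θ * x) := by gcongr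
      _ ≤ _ := by gcongr; exact le_max_left _ _

/-- If `y` converges and `y' = g + h`, where `h` converges and `g' → 0`, then `y' → 0`. Neither `g`
nor `y'` is assumed bounded. -/
theorem tendsto_deriv_zero_of_add {y y' g g' h : ℝ → ℝ} {l m : ℝ}
    (hy : ∀ x, 0 < x → HasDerivAt y (y' x) x) (hg : ∀ x, 0 < x → HasDerivAt g (g' x) x)
    (hsum : ∀ x, 0 < x → y' x = g x + h x) (hyl : Tendsto y atTop (𝓝 l))
    (hg' : Tendsto g' atTop (𝓝 0)) (hhm : Tendsto h atTop (𝓝 m)) :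
    Tendsto y' atTop (𝓝 0) := by
  rw [Metric.tendsto_atTop]
  intro ε hε
  have hδ : 0 < ε / 5 := by positivity
  obtain ⟨T₁, h₁⟩ := Metric.tendsto_atTop.1 hyl _ hδ
  obtain ⟨T₂, h₂⟩ := Metric.tendsto_atTop.1 hg' _ hδ
  obtain ⟨T₃, h₃⟩ := Metric.tendsto_atTop.1 hhm _ hδ
  refine ⟨max (max T₁ T₂) (max T₃ 1), fun x hx => ?_⟩
  simp only [ge_iff_le, max_le_iff] at hx
  obtain ⟨⟨hx1, hx2⟩, hx3, hx0⟩ := hx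
  have pos : ∀ s, x ≤ s → 0 < s := fun s hs => by linarith
  -- `y'` is small at some `ξ ∈ (x, x + 1)`, and varies little on `[x, x + 1]`.
  obtain ⟨ξ, hξ, hξe⟩ := exists_hasDerivAt_eq_slope y y' (lt_add_one x)
    (fun s hs => (hy s (pos s hs.1)).continuousAt.continuousWithinAt)
    (fun s hs => hy s (pos s hs.1.le))
  obtain ⟨η, hη, hηe⟩ := exists_hasDerivAt_eq_slope g g' hξ.1
    (fun s hs => (hg s (pos s hs.1)).continuousAt.continuousWithinAt)
    (fun s hs => hg s (pos s hs.1.le))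
  have hlen : 0 < ξ - x := by linarith [hξ.1]
  have a1 := abs_lt.1 (h₁ x hx1)
  have a2 := abs_lt.1 (h₁ (x + 1) (by linarith))
  have a3 := abs_lt.1 (h₃ x hx3)
  have a4 := abs_lt.1 (h₃ ξ (by linarith [hξ.1]))
  have a5 : |g ξ - g x| < ε / 5 := by
    have := h₂ η (by linarith [hη.1])
    rw [eq_div_iff hlen.ne'] at hηe
    rw [Real.dist_eq, sub_zero] at this
    rw [← hηe, abs_mul, abs_of_pos hlen]
    nlinarith [abs_nonneg (g' η), hξ.2]
  have a5 := abs_lt.1 a5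
  rw [add_sub_cancel_left, div_one] at hξe
  rw [hsum ξ (pos ξ hξ.1.le)] at hξe
  rw [Real.dist_eq, sub_zero, hsum x (pos x le_rfl), abs_lt]
  constructor <;> linarith [a1.1, a1.2, a2.1, a2.2, a3.1, a3.2, a4.1, a4.2, a5.1, a5.2]

/-! ### The Lyapunov equation -/

/-- If no two eigenvalues of `M` (possibly equal ones) have sum zero, which is expressed by the
coprimality of `χ(X)` and `χ(-X)`, then the Lyapunov equation `H M + Mᵀ H = 1` is solvable: the
operator on the left is injective, because `H M = -Mᵀ H` implies `H χ(M) = χ(-Mᵀ) H`. -/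
theorem Matrix.exists_lyapunov_of_isCoprime_charpoly {n : Type*} [Fintype n] [DecidableEq n]
    {K : Type*} [Field K] (M : Matrix n n K)
    (hM : IsCoprime M.charpoly (M.charpoly.comp (-X))) :
    ∃ H : Matrix n n K, H * M + Mᵀ * H = 1 := by
  let Φ : Matrix n n K →ₗ[K] Matrix n n K :=
    LinearMap.mulRight K M + LinearMap.mulLeft K Mᵀ
  have hΦ : ∀ H, Φ H = H * M + Mᵀ * H := fun H => rfl
  suffices hinj : Function.Injective Φ by
    obtain ⟨H, hH⟩ := LinearMap.injective_iff_surjective.1 hinj 1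
    exact ⟨H, by rw [← hΦ, hH]⟩
  rw [← LinearMap.ker_eq_bot, LinearMap.ker_eq_bot']
  intro H hH
  rw [hΦ, add_eq_zero_iff_eq_neg, ← neg_mul] at hH
  -- `H` intertwines `M` with `-Mᵀ`, hence also every polynomial in them.
  have key : ∀ p : K[X], H * aeval M p = aeval (-Mᵀ) p * H := fun p => by
    induction p using Polynomial.induction_on' with
    | add p q hp hq => simp only [map_add, mul_add, add_mul, hp, hq]
    | monomial k a =>
      have hk : H * M ^ k = (-Mᵀ) ^ k * H := by
        have : SemiconjBy H M (-Mᵀ) := hH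
        exact this.pow_right k
      rw [aeval_monomial, aeval_monomial, ← mul_assoc, ← Algebra.commutes, mul_assoc, hk,
        mul_assoc]
  have h1 : aeval (-Mᵀ) M.charpoly * H = 0 := by
    rw [← key, Matrix.aeval_self_charpoly, mul_zero]
  have h2 : aeval (-Mᵀ) (M.charpoly.comp (-X)) = 0 := by
    rw [aeval_comp, map_neg, aeval_X, neg_neg, ← Matrix.charpoly_transpose,
      Matrix.aeval_self_charpoly]
  obtain ⟨a, b, hab⟩ := hM
  have h3 := congrArg (fun p => aeval (-Mᵀ) p * H) hab
  simpa [add_mul, mul_assoc, h1, h2] using h3.symm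

/-- For the quintic `∑ aᵢ xⁱ = E(x²) + x O(x²)`, the resultant of the quadratic
polynomials `E = a₀ + a₂ y + a₄ y²` and `O = a₁ + a₃ y + a₅ y²`. -/
def evenOddResultant {R : Type*} [CommRing R] (a : Fin 6 → R) : R :=
  (a 0 * a 5 - a 4 * a 1) ^ 2 - (a 0 * a 3 - a 2 * a 1) * (a 2 * a 5 - a 4 * a 3)

/-- A common root of `P(X)` and `P(-X)` is `0` or its square is a common root of the even and the odd
part of `P`. -/
theorem isCoprime_comp_neg_X_of_evenOddResultant_ne_zero {K : Type*} [Field K] [CharZero K]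
    {a : Fin 6 → K} (h₀ : a 0 ≠ 0) (hR : evenOddResultant a ≠ 0) :
    IsCoprime (∑ i : Fin 6, C (a i) * X ^ (i : ℕ))
      ((∑ i : Fin 6, C (a i) * X ^ (i : ℕ)).comp (-X)) := by
  set r := evenOddResultant a with hr
  have hκ : 2 * r * a 0 ^ 2 ≠ 0 := by simp [h₀, hR]
  have hunit : C (2 * r * a 0 ^ 2)⁻¹ * C (2 * r * a 0 ^ 2) = (1 : K[X]) := by
    rw [← C_mul, inv_mul_cancel₀ hκ, C_1]
  -- With `E` and `O` the even and odd parts, and `w = X²`, elimination gives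
  -- `r w = α w (a₄ O - a₅ E) - β (a₁ E - a₀ O)`, and `a₀ = E - w s` then removes the powers of `X`;
  -- finally `2 E(w)` and `2 X O(w)` are the sum and difference of `P(X)` and `P(-X)`.
  let α : K[X] := C (a 1 * a 4 - a 0 * a 5)
  let β : K[X] := C (a 3 * a 4 - a 2 * a 5)
  let s : K[X] := C (a 2) + C (a 4) * X ^ 2
  let e : K[X] := C r * (C (a 0) - X ^ 2 * s)
  have h2 : (C (2 : K) : K[X]) = 2 := map_ofNat C 2
  obtain ⟨A, B, hAB⟩ : ∃ A B : K[X], A * (∑ i : Fin 6, C (a i) * X ^ (i : ℕ))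
      + B * (∑ i : Fin 6, C (a i) * X ^ (i : ℕ)).comp (-X) = C (2 * r * a 0 ^ 2) := by
    refine ⟨e + X * s ^ 2 * (α * X ^ 2 * (C (a 4) - C (a 5) * X) - β * (C (a 1) * X - C (a 0))),
      e + X * s ^ 2 * (α * X ^ 2 * (-C (a 4) - C (a 5) * X) - β * (C (a 1) * X + C (a 0))), ?_⟩
    simp only [e, α, β, s, hr, evenOddResultant, Fin.sum_univ_six]
    simp [h2]
    ring
  exact ⟨C (2 * r * a 0 ^ 2)⁻¹ * A, C (2 * r * a 0 ^ 2)⁻¹ * B, by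
    linear_combination C (2 * r * a 0 ^ 2)⁻¹ * hAB + hunit⟩

/-! ### The linearization at an equilibrium -/

namespace MTParams

/-- The linearization at the equilibrium `(p, q, c)` of the steady-state equation, reduced to five
dimensions by the conserved flux. The unknowns are the deviations of `p⁺`, `p⁻`, `c`, of the flux
`d (p⁺)' - u c p⁺`, and of `c'`. -/
noncomputable def linMatrix (π : MTParams) (p q c : ℝ) : Matrix (Fin 5) (Fin 5) ℝ :=
  !![π.u * c / π.d, 0, π.u * p / π.d, 1 / π.d, 0;
     0, -(π.v / π.d), 0, -(1 / π.d), 0;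
     0, 0, 0, 0, 1;
     π.f, -(π.w * c), -(π.w * q), 0, 0;
     π.u * c / π.D, -(π.v / π.D), (π.u * p + π.k) / π.D, 0, 0]

/-- The coefficients, from degree `0` to degree `5`, of `d² D` times the characteristic polynomial
of `linMatrix`. -/
def charCoeff (π : MTParams) (p q c : ℝ) : Fin 6 → ℝ :=
  ![π.k * (π.v * π.f - π.u * π.w * c ^ 2),
    π.d * (π.w * c + π.f) * (π.u * p + π.k) + π.d * π.w * q * (π.v + π.u * c) + π.u * π.v * π.k * c,
    π.u * π.w * π.D * c ^ 2 + π.u * π.d * π.k * c - π.v * π.d * (π.u * p + π.k) - π.v * π.f * π.D,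
    -(π.d * π.D * (π.w * c + π.f)) - π.d ^ 2 * (π.u * p + π.k) - π.u * π.v * π.D * c,
    π.d * π.D * (π.v - π.u * c),
    π.d ^ 2 * π.D]

theorem charpoly_linMatrix (π : MTParams) (p q c : ℝ) :
    (π.linMatrix p q c).charpoly =
      Polynomial.C (π.d ^ 2 * π.D)⁻¹ *
        ∑ i : Fin 6, Polynomial.C (π.charCoeff p q c i) * X ^ (i : ℕ) := by
  have hd := π.d_pos.ne'
  have hD := π.D_pos.ne'
  refine Polynomial.funext fun x => ?_
  rw [Matrix.eval_charpoly]
  simp [linMatrix, charCoeff, Matrix.det_succ_row_zero, Fin.sum_univ_succ,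
    Fin.succAbove]
  field_simp
  ring

/-- The coefficients `charCoeff` along the equilibrium curve, in terms of `t = 1 / c`, multiplied by
`t² (v f t² - u w)` and divided by their common power of `t`, which is `0, 1, 0, 1, 1, 2` for the
degrees `0` to `5`. They are polynomials in `t`. -/
def scaledCoeff (π : MTParams) (t : ℝ) : Fin 6 → ℝ :=
  let g := π.v * π.f * t ^ 2 - π.u * π.w
  let h := π.v * π.f * π.k * t ^ 2
  ![π.k * g ^ 2,
    π.d * (π.w + π.f * t) * h + π.d * π.w * π.k * π.f * t * (π.v * t + π.u) + π.u * π.v * π.k * g,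
    (π.u * π.w * π.D + π.u * π.d * π.k * t - π.v * π.f * π.D * t ^ 2) * g - π.v * π.d * t ^ 2 * h,
    -(π.d * π.D * (π.w + π.f * t) + π.u * π.v * π.D) * g - π.d ^ 2 * t * h,
    π.d * π.D * (π.v * t - π.u) * g,
    π.d ^ 2 * π.D * g]

/-- `evenOddResultant` of the multiplied coefficients along the equilibrium curve, divided by
`t³`. -/
def scaledResultant (π : MTParams) (t : ℝ) : ℝ :=
  let b := π.scaledCoeff t
  t * (b 0 * b 5 - b 4 * b 1) ^ 2 - (b 0 * b 3 - b 2 * b 1) * (b 2 * b 5 - b 4 * b 3)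

/-- The polynomial `scaledResultant` does not vanish identically, since its value at `t = 0`, which
stands for `c = ∞`, is a nonzero monomial in the constants. The physical end `c = 0` does not
serve: there the eigenvalues are `±√(f / d)`, `±√(k / D)`, `-v / d`, and the resultant vanishes. -/
theorem finite_scaledResultant_eq_zero (π : MTParams) : {t | π.scaledResultant t = 0}.Finite := by
  obtain ⟨S, hS⟩ : ∃ S : ℝ[X], ∀ t, S.eval t = π.scaledResultant t := by
    let κ : ℝ →+* ℝ[X] := Polynomial.C
    let g : ℝ[X] := κ (π.v * π.f) * X ^ 2 - κ (π.u * π.w)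
    let h : ℝ[X] := κ (π.v * π.f * π.k) * X ^ 2
    let b : Fin 6 → ℝ[X] :=
      ![κ π.k * g ^ 2,
        κ π.d * (κ π.w + κ π.f * X) * h
          + κ (π.d * π.w * π.k * π.f) * X * (κ π.v * X + κ π.u) + κ (π.u * π.v * π.k) * g,
        (κ (π.u * π.w * π.D) + κ (π.u * π.d * π.k) * X - κ (π.v * π.f * π.D) * X ^ 2) * g
          - κ (π.v * π.d) * X ^ 2 * h,
        -(κ (π.d * π.D) * (κ π.w + κ π.f * X) + κ (π.u * π.v * π.D)) * g - κ (π.d ^ 2) * X * h,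
        κ (π.d * π.D) * (κ π.v * X - κ π.u) * g,
        κ (π.d ^ 2 * π.D) * g]
    have hb : ∀ t i, (b i).eval t = π.scaledCoeff t i := fun t i => by
      fin_cases i <;> simp [b, g, h, κ, scaledCoeff]
    refine ⟨X * (b 0 * b 5 - b 4 * b 1) ^ 2
      - (b 0 * b 3 - b 2 * b 1) * (b 2 * b 5 - b 4 * b 3), fun t => ?_⟩
    simp [scaledResultant, hb]
  have h0 : S.eval 0 = π.u ^ 7 * π.v * π.k * π.w ^ 6 * π.d ^ 2 * π.D ^ 3 := by
    rw [hS]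
    simp [scaledResultant, scaledCoeff]
    ring
  have hne : S ≠ 0 := by
    rintro rfl
    have := π.u_pos; have := π.v_pos; have := π.k_pos; have := π.w_pos
    have := π.d_pos; have := π.D_pos
    rw [eval_zero] at h0
    exact absurd h0 (by positivity)
  refine (S.rootSet_finite ℝ).subset fun t ht => ?_
  rw [mem_rootSet]
  exact ⟨hne, by simpa [hS] using ht⟩

theorem evenOddResultant_charCoeff_ne_zero (π : MTParams) {c : ℝ} (hc : c ≠ 0)
    (hG : π.v * π.f - π.u * π.w * c ^ 2 ≠ 0) (hS : π.scaledResultant c⁻¹ ≠ 0) :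
    evenOddResultant (π.charCoeff (π.w * π.k * c ^ 2 / (π.v * π.f - π.u * π.w * c ^ 2))
      (π.k * c * π.f / (π.v * π.f - π.u * π.w * c ^ 2)) c) ≠ 0 := by
  set G := π.v * π.f - π.u * π.w * c ^ 2 with hGdef
  set a := π.charCoeff (π.w * π.k * c ^ 2 / G) (π.k * c * π.f / G) c with ha
  set b := π.scaledCoeff c⁻¹ with hb
  have hg : π.v * π.f * (c⁻¹) ^ 2 - π.u * π.w = G / c ^ 2 := by
    rw [hGdef]; field_simp
  -- `m` is `t² (v f t² - u w)` for `t = 1 / c`.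
  set m := G / c ^ 4 with hm
  have e0 : m * a 0 = b 0 := by
    simp only [ha, hb, charCoeff, scaledCoeff, hg, hm, Matrix.cons_val]
    rw [← hGdef]; field_simp
  have e1 : m * a 1 = c⁻¹ * b 1 := by
    simp only [ha, hb, charCoeff, scaledCoeff, hg, hm, Matrix.cons_val]
    field_simp; rw [hGdef]; ring
  have e2 : m * a 2 = b 2 := by
    simp only [ha, hb, charCoeff, scaledCoeff, hg, hm, Matrix.cons_val]
    field_simp; rw [hGdef]; ring
  have e3 : m * a 3 = c⁻¹ * b 3 := by
    simp only [ha, hb, charCoeff, scaledCoeff, hg, hm, Matrix.cons_val]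
    field_simp; rw [hGdef]; ring
  have e4 : m * a 4 = c⁻¹ * b 4 := by
    simp only [ha, hb, charCoeff, scaledCoeff, hg, hm, Matrix.cons_val]
    field_simp
  have e5 : m * a 5 = c⁻¹ ^ 2 * b 5 := by
    simp only [ha, hb, charCoeff, scaledCoeff, hg, hm, Matrix.cons_val]
    field_simp
  have key : m ^ 4 * evenOddResultant a = c⁻¹ ^ 3 * π.scaledResultant c⁻¹ := by
    calc m ^ 4 * evenOddResultant a = evenOddResultant (fun i => m * a i) := by
          simp only [evenOddResultant]; ring
      _ = c⁻¹ ^ 3 * π.scaledResultant c⁻¹ := by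
          simp only [evenOddResultant, e0, e1, e2, e3, e4, e5, scaledResultant, ← hb]; ring
  intro h
  rw [h, mul_zero] at key
  exact mul_ne_zero (pow_ne_zero 3 (inv_ne_zero hc)) hS key.symm

theorem exists_lyapunov_linMatrix (π : MTParams) {p q c : ℝ}
    (hG : π.v * π.f - π.u * π.w * c ^ 2 ≠ 0) (hR : evenOddResultant (π.charCoeff p q c) ≠ 0) :
    ∃ H, H * π.linMatrix p q c + (π.linMatrix p q c)ᵀ * H = 1 := by
  refine Matrix.exists_lyapunov_of_isCoprime_charpoly _ ?_
  have hu : IsUnit (Polynomial.C (π.d ^ 2 * π.D)⁻¹ : ℝ[X]) :=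
    isUnit_C.2 (inv_ne_zero (mul_ne_zero (pow_ne_zero 2 π.d_pos.ne') π.D_pos.ne')).isUnit
  rw [charpoly_linMatrix, mul_comp, C_comp, isCoprime_mul_unit_left hu]
  exact isCoprime_comp_neg_X_of_evenOddResultant_ne_zero
    (mul_ne_zero π.k_pos.ne' hG) hR

end MTParams

/-! ### Coordinates in Euclidean space -/

theorem EuclideanSpace.norm_le_sum_abs {ι : Type*} [Fintype ι] (x : EuclideanSpace ℝ ι) :
    ‖x‖ ≤ ∑ i, |x i| := by
  rw [EuclideanSpace.norm_eq]
  refine Real.sqrt_le_iff.2 ⟨by positivity, ?_⟩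
  exact Finset.sum_sq_le_sq_sum_of_nonneg fun i _ => abs_nonneg _

theorem EuclideanSpace.abs_apply_le_norm {ι : Type*} [Fintype ι] (x : EuclideanSpace ℝ ι) (i : ι) :
    |x i| ≤ ‖x‖ := PiLp.norm_apply_le x i

theorem EuclideanSpace.hasDerivWithinAt_iff {ι : Type*} [Fintype ι] {f : ℝ → EuclideanSpace ℝ ι}
    {f' : EuclideanSpace ℝ ι} {s : Set ℝ} {x : ℝ} :
    HasDerivWithinAt f f' s x ↔ ∀ i, HasDerivWithinAt (fun t => f t i) (f' i) s x := by
  simp only [hasDerivWithinAt_iff_hasFDerivWithinAt, hasFDerivWithinAt_euclidean]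
  refine forall_congr' fun i => ?_
  have : EuclideanSpace.proj i ∘L ContinuousLinearMap.toSpanSingleton ℝ f'
      = ContinuousLinearMap.toSpanSingleton ℝ (f' i) := by
    ext; simp
  rw [this]

/-- `exists_uniform_exp_decay_of_lyapunov` for matrices. -/
theorem exists_uniform_exp_decay_of_matrix_lyapunov {n : Type*} [Fintype n] [DecidableEq n]
    {M H : Matrix n n ℝ} (hH : H * M + Mᵀ * H = 1) {C : ℝ} (hC : 0 ≤ C) :
    ∃ θ : ℝ, 0 < θ ∧ ∀ z N : ℝ → EuclideanSpace ℝ n,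
      (∀ x, 0 ≤ x → HasDerivWithinAt z (WithLp.toLp 2 (M *ᵥ (z x).ofLp) + N x) (Ici 0) x) →
      (∀ x, 0 ≤ x → ‖N x‖ ≤ C * ‖z x‖ ^ 2) →
      Tendsto z atTop (𝓝 0) →
      ∃ K : ℝ, ∀ x, 0 ≤ x → ‖z x‖ ≤ K * Real.exp (-θ * x) := by
  refine exists_uniform_exp_decay_of_lyapunov (Matrix.toEuclideanCLM (n := n) (𝕜 := ℝ) M)
    (Matrix.toEuclideanCLM (n := n) (𝕜 := ℝ) H) (fun z => ?_) hC
  set Φ := Matrix.toEuclideanCLM (n := n) (𝕜 := ℝ)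
  have hstar : Φ Mᵀ = ContinuousLinearMap.adjoint (Φ M) := by
    rw [← ContinuousLinearMap.star_eq_adjoint, ← map_star, Matrix.star_eq_conjTranspose,
      Matrix.conjTranspose_eq_transpose_of_trivial]
  have h1 : Φ H (Φ M z) + Φ Mᵀ (Φ H z) = z := by
    have := congrArg (fun A => Φ A z) hH
    rw [map_add, map_mul, map_mul, map_one] at this
    exact this
  rw [← ContinuousLinearMap.adjoint_inner_left, ← hstar, ← inner_add_left, h1,
    real_inner_self_eq_norm_sq]

/-! ### Orbits converging to an equilibrium -/

namespace MTParams

variable {π : MTParams} {U P : ℝ → MTState}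

theorem IsSteadyOrbit.hasDerivWithinAt_U (h : π.IsSteadyOrbit U P) {x : ℝ} (hx : 0 ≤ x)
    (i : Fin 3) : HasDerivWithinAt (fun s => U s i) (P x i) (Ici 0) x :=
  EuclideanSpace.hasDerivWithinAt_iff.1 (h x hx).1 i

theorem IsSteadyOrbit.hasDerivWithinAt_P (h : π.IsSteadyOrbit U P) {x : ℝ} (hx : 0 ≤ x) :
    HasDerivWithinAt (fun s => P s 0) ((π.u * (U x 2 * P x 0 + U x 0 * P x 2)
        + π.f * U x 0 - π.w * U x 2 * U x 1) / π.d) (Ici 0) x ∧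
    HasDerivWithinAt (fun s => P s 1)
      ((-(π.v * P x 1) - π.f * U x 0 + π.w * U x 2 * U x 1) / π.d) (Ici 0) x ∧
    HasDerivWithinAt (fun s => P s 2)
      ((π.u * U x 2 * U x 0 - π.v * U x 1 + π.k * U x 2) / π.D) (Ici 0) x := by
  obtain ⟨-, Q, hQ, he⟩ := h x hx
  have hQ' := EuclideanSpace.hasDerivWithinAt_iff.1 hQ
  have hd := π.d_pos.ne'
  have hD := π.D_pos.ne'
  have e0 := congrFun he 0
  have e1 := congrFun he 1
  have e2 := congrFun he 2
  simp [A, B, MTParams.C, dotProduct, Fin.sum_univ_three] at e0 e1 e2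
  refine ⟨?_, ?_, ?_⟩
  · convert hQ' 0 using 1
    rw [div_eq_iff hd]; linarith
  · convert hQ' 1 using 1
    rw [div_eq_iff hd]; linarith
  · convert hQ' 2 using 1
    rw [div_eq_iff hD]; linarith

/-- `V` is a constant solution of the steady-state equation. -/
def IsEquilibrium (π : MTParams) (V : MTState) : Prop :=
  π.f * V 0 = π.w * V 2 * V 1 ∧ π.v * V 1 = π.u * V 2 * V 0 + π.k * V 2

/-- Convergence of `U` to an equilibrium entails `U' → 0`: up to multiples of `c p⁺` and `p⁻`, which
converge, `U'` has a derivative that is a function of `U` alone and vanishes at the equilibrium. -/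
theorem IsSteadyOrbit.tendsto_deriv (h : π.IsSteadyOrbit U P) {V : MTState}
    (hV : π.IsEquilibrium V) (hU : Tendsto U atTop (𝓝 V)) (i : Fin 3) :
    Tendsto (fun x => P x i) atTop (𝓝 0) := by
  have lim : ∀ i, Tendsto (fun x => U x i) atTop (𝓝 (V i)) := fun i =>
    ((EuclideanSpace.proj (𝕜 := ℝ) i).continuous.tendsto V).comp hU
  have dU : ∀ i x, 0 < x → HasDerivAt (fun s => U s i) (P x i) x := fun i x hx =>
    (h.hasDerivWithinAt_U hx.le i).hasDerivAt (Ici_mem_nhds hx)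
  have dP := fun x (hx : 0 < x) => h.hasDerivWithinAt_P hx.le
  have hd := π.d_pos.ne'
  obtain ⟨h1, h2⟩ := hV
  fin_cases i
  · refine tendsto_deriv_zero_of_add (g := fun x => P x 0 - π.u / π.d * (U x 2 * U x 0))
      (g' := fun x => (π.f * U x 0 - π.w * U x 2 * U x 1) / π.d)
      (h := fun x => π.u / π.d * (U x 2 * U x 0)) (dU 0) (fun x hx => ?_)
      (fun x _ => by simp) (lim 0) ?_ (((lim 2).mul (lim 0)).const_mul _)
    · refine HasDerivAt.congr_deriv (((dP x hx).1.hasDerivAt (Ici_mem_nhds hx)).sub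
        (((dU 2 x hx).mul (dU 0 x hx)).const_mul (π.u / π.d))) ?_
      field_simp; ring
    · have := (((lim 0).const_mul π.f).sub (((lim 2).const_mul π.w).mul (lim 1))).div_const π.d
      rwa [h1, sub_self, zero_div] at this
  · refine tendsto_deriv_zero_of_add (g := fun x => P x 1 + π.v / π.d * U x 1)
      (g' := fun x => (-(π.f * U x 0) + π.w * U x 2 * U x 1) / π.d)
      (h := fun x => -(π.v / π.d) * U x 1) (dU 1) (fun x hx => ?_)
      (fun x _ => by simp) (lim 1) ?_ ((lim 1).const_mul _)
    · refine HasDerivAt.congr_deriv (((dP x hx).2.1.hasDerivAt (Ici_mem_nhds hx)).add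
        ((dU 1 x hx).const_mul (π.v / π.d))) ?_
      field_simp; ring
    · have := (((lim 0).const_mul π.f).neg.add (((lim 2).const_mul π.w).mul (lim 1))).div_const π.d
      rwa [h1, neg_add_cancel, zero_div] at this
  · refine tendsto_deriv_zero_of_add (g := fun x => P x 2) (m := 0) (h := fun _ => 0) (dU 2)
      (fun x hx => (dP x hx).2.2.hasDerivAt (Ici_mem_nhds hx)) (fun x _ => by simp) (lim 2) ?_
      tendsto_const_nhds
    have := ((((lim 2).const_mul π.u).mul (lim 0)).sub ((lim 1).const_mul π.v)).add
      ((lim 2).const_mul π.k) |>.div_const π.D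
    rwa [h2, sub_add_eq_add_sub, sub_self, zero_div] at this

/-- The sum of the equations for `p⁺` and `p⁻` is an exact derivative. The total flux is thus
constant along an orbit, and an orbit converging to `V` has the flux of `V`. -/
theorem IsSteadyOrbit.flux_eq (h : π.IsSteadyOrbit U P) {V : MTState}
    (hV : π.IsEquilibrium V) (hU : Tendsto U atTop (𝓝 V)) {x : ℝ} (hx : 0 ≤ x) :
    π.d * (P x 0 + P x 1) - π.u * (U x 2 * U x 0) + π.v * U x 1
      = -(π.u * (V 2 * V 0)) + π.v * V 1 := by
  set I : ℝ → ℝ := fun x => π.d * (P x 0 + P x 1) - π.u * (U x 2 * U x 0) + π.v * U x 1 with hI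
  have hd := π.d_pos.ne'
  have dI : ∀ s, 0 ≤ s → HasDerivWithinAt I 0 (Ici 0) s := fun s hs => by
    obtain ⟨d0, d1, -⟩ := h.hasDerivWithinAt_P hs
    refine HasDerivWithinAt.congr_deriv
      ((((d0.add d1).const_mul π.d).sub (((h.hasDerivWithinAt_U hs 2).mul
      (h.hasDerivWithinAt_U hs 0)).const_mul π.u)).add
      ((h.hasDerivWithinAt_U hs 1).const_mul π.v)) ?_
    field_simp; ring
  have hconst : ∀ s, 0 ≤ s → I s = I 0 := fun s hs =>
    constant_of_has_deriv_right_zero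
      (fun t ht => ((dI t ht.1).mono Icc_subset_Ici_self).continuousWithinAt)
      (fun t ht => (dI t ht.1).mono (Ici_subset_Ici.2 ht.1)) s ⟨hs, le_rfl⟩
  have lim : ∀ i, Tendsto (fun x => U x i) atTop (𝓝 (V i)) := fun i =>
    ((EuclideanSpace.proj (𝕜 := ℝ) i).continuous.tendsto V).comp hU
  have hlim := ((((h.tendsto_deriv hV hU 0).add (h.tendsto_deriv hV hU 1)).const_mul π.d).sub
    (((lim 2).mul (lim 0)).const_mul π.u)).add ((lim 1).const_mul π.v)
  have hlim' : Tendsto I atTop (𝓝 (I x)) := by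
    refine tendsto_const_nhds.congr' ((eventually_ge_atTop 0).mono fun s hs => ?_)
    rw [hconst x hx, hconst s hs]
  have := tendsto_nhds_unique hlim' hlim
  change I x = _
  rw [this]; ring

/-- The coordinates of an orbit relative to the equilibrium `V` in which `linMatrix` is written. The
component `(p⁻)'` is absent, being determined by the conserved flux. -/
def deviation (π : MTParams) (V : MTState) (U P : ℝ → MTState) (x : ℝ) : EuclideanSpace ℝ (Fin 5) :=
  !₂[U x 0 - V 0, U x 1 - V 1, U x 2 - V 2,
    π.d * P x 0 - π.u * (U x 2 * U x 0 - V 2 * V 0), P x 2]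

/-- The quadratic terms of the reduced system in the coordinates `deviation`. -/
noncomputable def nonlinearPart (π : MTParams) (z : EuclideanSpace ℝ (Fin 5)) :
    EuclideanSpace ℝ (Fin 5) :=
  !₂[π.u * (z 0 * z 2) / π.d, 0, 0, -(π.w * (z 1 * z 2)), π.u * (z 0 * z 2) / π.D]

theorem norm_nonlinearPart_le (π : MTParams) (z : EuclideanSpace ℝ (Fin 5)) :
    ‖π.nonlinearPart z‖ ≤ (π.u / π.d + π.w + π.u / π.D) * ‖z‖ ^ 2 := by
  have hu := π.u_pos; have hw := π.w_pos; have hd := π.d_pos; have hD := π.D_pos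
  have hz : ∀ i j, |z i * z j| ≤ ‖z‖ ^ 2 := fun i j => by
    rw [abs_mul, sq]
    exact mul_le_mul (EuclideanSpace.abs_apply_le_norm z i) (EuclideanSpace.abs_apply_le_norm z j)
      (abs_nonneg _) (norm_nonneg _)
  refine (EuclideanSpace.norm_le_sum_abs _).trans ?_
  simp only [nonlinearPart, Fin.sum_univ_five, Matrix.cons_val, abs_neg, abs_zero]
  rw [mul_div_right_comm, mul_div_right_comm, abs_mul (π.u / π.d), abs_mul π.w,
    abs_mul (π.u / π.D), abs_of_pos hw, abs_of_pos (div_pos hu hd), abs_of_pos (div_pos hu hD)]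
  have h1 := mul_le_mul_of_nonneg_left (hz 0 2) (div_pos hu hd).le
  have h2 := mul_le_mul_of_nonneg_left (hz 1 2) hw.le
  have h3 := mul_le_mul_of_nonneg_left (hz 0 2) (div_pos hu hD).le
  linarith

theorem IsSteadyOrbit.hasDerivWithinAt_deviation (h : π.IsSteadyOrbit U P) {V : MTState}
    (hV : π.IsEquilibrium V) (hU : Tendsto U atTop (𝓝 V)) {x : ℝ} (hx : 0 ≤ x) :
    HasDerivWithinAt (π.deviation V U P)
      (WithLp.toLp 2 (π.linMatrix (V 0) (V 1) (V 2) *ᵥ (π.deviation V U P x).ofLp)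
        + π.nonlinearPart (π.deviation V U P x)) (Ici 0) x := by
  have hd := π.d_pos.ne'
  have hD := π.D_pos.ne'
  have dU := h.hasDerivWithinAt_U hx
  obtain ⟨d0, d1, d2⟩ := h.hasDerivWithinAt_P hx
  have hI := h.flux_eq hV hU hx
  obtain ⟨h1, h2⟩ := hV
  rw [EuclideanSpace.hasDerivWithinAt_iff]
  intro i
  fin_cases i
  · refine HasDerivWithinAt.congr_deriv ((dU 0).sub_const (V 0)) ?_
    simp [deviation, nonlinearPart, linMatrix]
    field_simp; ring
  · refine HasDerivWithinAt.congr_deriv ((dU 1).sub_const (V 1)) ?_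
    simp [deviation, nonlinearPart, linMatrix]
    field_simp; linarith
  · refine HasDerivWithinAt.congr_deriv ((dU 2).sub_const (V 2)) ?_
    simp [deviation, nonlinearPart, linMatrix]
  · refine HasDerivWithinAt.congr_deriv ((d0.const_mul π.d).sub
      ((((dU 2).mul (dU 0)).sub_const (V 2 * V 0)).const_mul π.u)) ?_
    simp [deviation, nonlinearPart, linMatrix]
    field_simp; linarith
  · refine HasDerivWithinAt.congr_deriv (d2) ?_
    simp [deviation, nonlinearPart, linMatrix]
    field_simp; linarith

theorem IsSteadyOrbit.tendsto_deviation (h : π.IsSteadyOrbit U P) {V : MTState}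
    (hV : π.IsEquilibrium V) (hU : Tendsto U atTop (𝓝 V)) :
    Tendsto (π.deviation V U P) atTop (𝓝 0) := by
  have lim : ∀ i, Tendsto (fun x => U x i) atTop (𝓝 (V i)) := fun i =>
    ((EuclideanSpace.proj (𝕜 := ℝ) i).continuous.tendsto V).comp hU
  have limP := h.tendsto_deriv hV hU
  have : Tendsto (fun x => (π.deviation V U P x).ofLp) atTop (𝓝 0) := by
    rw [tendsto_pi_nhds]
    intro i
    fin_cases i
    · simpa [deviation] using (lim 0).sub_const (V 0)
    · simpa [deviation] using (lim 1).sub_const (V 1)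
    · simpa [deviation] using (lim 2).sub_const (V 2)
    · simpa [deviation] using ((limP 0).const_mul π.d).sub
        ((((lim 2).mul (lim 0)).sub_const (V 2 * V 0)).const_mul π.u)
    · simpa [deviation] using limP 2
  exact ((PiLp.continuous_toLp 2 (fun _ : Fin 5 => ℝ)).tendsto 0).comp this

theorem IsSteadyOrbit.norm_le_deviation (h : π.IsSteadyOrbit U P) {V : MTState}
    (hV : π.IsEquilibrium V) (hU : Tendsto U atTop (𝓝 V)) {x : ℝ} (hx : 0 ≤ x) :
    ‖U x - V‖ + ‖P x‖ ≤ (4 + (2 + π.v + π.u * (|V 2| + |V 0| + ‖π.deviation V U P x‖)) / π.d)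
      * ‖π.deviation V U P x‖ := by
  have hu := π.u_pos; have hv := π.v_pos; have hd := π.d_pos
  set z := π.deviation V U P x with hz
  have hI := h.flux_eq hV hU hx
  have habs := EuclideanSpace.abs_apply_le_norm z
  have z0 : z 0 = U x 0 - V 0 := rfl
  have z1 : z 1 = U x 1 - V 1 := rfl
  have z2 : z 2 = U x 2 - V 2 := rfl
  have z3 : z 3 = π.d * P x 0 - π.u * (U x 2 * U x 0 - V 2 * V 0) := rfl
  have z4 : z 4 = P x 2 := rfl
  have n0 := norm_nonneg z
  have p0 : |P x 0| ≤ (1 + π.u * (|V 2| + |V 0| + ‖z‖)) / π.d * ‖z‖ := by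
    have e : P x 0 = (z 3 + π.u * (V 2 * z 0 + V 0 * z 2 + z 0 * z 2)) / π.d := by
      rw [eq_div_iff hd.ne', z0, z2, z3]; ring
    rw [e, abs_div, abs_of_pos hd, div_mul_eq_mul_div]
    gcongr
    calc |z 3 + π.u * (V 2 * z 0 + V 0 * z 2 + z 0 * z 2)|
        ≤ |z 3| + π.u * (|V 2| * |z 0| + |V 0| * |z 2| + |z 0| * |z 2|) := by
          refine (abs_add_le _ _).trans ?_
          rw [abs_mul π.u, abs_of_pos hu, ← abs_mul, ← abs_mul, ← abs_mul]
          gcongr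
          exact abs_add_three _ _ _
      _ ≤ ‖z‖ + π.u * (|V 2| * ‖z‖ + |V 0| * ‖z‖ + ‖z‖ * ‖z‖) := by
          gcongr <;> exact habs _
      _ = _ := by ring
  have p1 : |P x 1| ≤ (1 + π.v) / π.d * ‖z‖ := by
    have e : P x 1 = -(z 3 + π.v * z 1) / π.d := by
      rw [eq_div_iff hd.ne', z1, z3]; linarith
    rw [e, abs_div, abs_of_pos hd, div_mul_eq_mul_div, abs_neg]
    gcongr
    calc |z 3 + π.v * z 1| ≤ |z 3| + π.v * |z 1| := by
          rw [← abs_of_pos hv, ← abs_mul, abs_of_pos hv]; exact abs_add_le _ _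
      _ ≤ ‖z‖ + π.v * ‖z‖ := by gcongr <;> exact habs _
      _ = _ := by ring
  have hUV : ‖U x - V‖ ≤ 3 * ‖z‖ := by
    refine (EuclideanSpace.norm_le_sum_abs _).trans ?_
    simp only [Fin.sum_univ_three, PiLp.sub_apply, ← z0, ← z1, ← z2]
    linarith [habs 0, habs 1, habs 2]
  have hP : ‖P x‖ ≤ |P x 0| + |P x 1| + ‖z‖ := by
    refine (EuclideanSpace.norm_le_sum_abs _).trans ?_
    rw [Fin.sum_univ_three, ← z4]
    linarith [habs 4]
  calc _ ≤ 3 * ‖z‖ + ((1 + π.u * (|V 2| + |V 0| + ‖z‖)) / π.d * ‖z‖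
        + (1 + π.v) / π.d * ‖z‖ + ‖z‖) := by linarith
    _ = _ := by ring

theorem uniformExponentialConvergence_of_lyapunov {V : MTState} (hV : π.IsEquilibrium V)
    {H : Matrix (Fin 5) (Fin 5) ℝ}
    (hH : H * π.linMatrix (V 0) (V 1) (V 2) + (π.linMatrix (V 0) (V 1) (V 2))ᵀ * H = 1) :
    π.UniformExponentialConvergence V := by
  have hu := π.u_pos; have hv := π.v_pos; have hw := π.w_pos; have hd := π.d_pos
  have hD := π.D_pos
  obtain ⟨θ, hθ, hdecay⟩ := exists_uniform_exp_decay_of_matrix_lyapunov hH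
    (C := π.u / π.d + π.w + π.u / π.D) (by positivity)
  refine ⟨θ, hθ, fun U P h hU => ?_⟩
  obtain ⟨K, hK⟩ := hdecay (π.deviation V U P) (fun x => π.nonlinearPart (π.deviation V U P x))
    (fun x hx => h.hasDerivWithinAt_deviation hV hU hx) (fun x _ => π.norm_nonlinearPart_le _)
    (h.tendsto_deviation hV hU)
  have hK0 : 0 ≤ K := by simpa using (norm_nonneg _).trans (hK 0 le_rfl)
  refine ⟨(4 + (2 + π.v + π.u * (|V 2| + |V 0| + K)) / π.d) * K, fun x hx => ?_⟩
  have hz := hK x hx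
  have hzK : ‖π.deviation V U P x‖ ≤ K := hz.trans <| mul_le_of_le_one_right hK0 <|
    Real.exp_le_one_iff.2 (by nlinarith)
  rw [mul_assoc]
  refine (h.norm_le_deviation hV hU hx).trans ?_
  gcongr

theorem mem_equilibriumCurve_isEquilibrium {V : MTState} (hV : V ∈ π.equilibriumCurve) :
    π.IsEquilibrium V := by
  obtain ⟨c, -, hG, rfl⟩ := hV
  have hG' := hG.ne'
  constructor
  · simp only [Matrix.cons_val]
    field_simp
  · simp only [Matrix.cons_val]
    rw [mul_div_assoc', mul_div_assoc', div_add' _ _ _ hG', div_left_inj' hG']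
    ring

end MTParams

/-! ### Generic equilibria -/

theorem mainTheorem2 (π : MTParams) :
    MeasureTheory.Measure.hausdorffMeasure 1
      {Uplus : MTState | Uplus ∈ π.equilibriumCurve ∧
        ¬ π.UniformExponentialConvergence Uplus} = 0 := by
  let γ : ℝ → MTState := fun c =>
    !₂[π.w * π.k * c ^ 2 / (π.v * π.f - π.u * π.w * c ^ 2),
       π.k * c * π.f / (π.v * π.f - π.u * π.w * c ^ 2), c]
  have hfin : ({0} ∪ {c : ℝ | π.scaledResultant c⁻¹ = 0}).Finite :=
    (finite_singleton 0).union
      (π.finite_scaledResultant_eq_zero.preimage inv_injective.injOn)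
  have := MeasureTheory.Measure.nullSingletonClass_hausdorff MTState (d := 1) one_pos
  refine MeasureTheory.measure_mono_null ?_ ((hfin.image γ).measure_zero _)
  rintro V ⟨hV, hnot⟩
  have hVeq := MTParams.mem_equilibriumCurve_isEquilibrium hV
  obtain ⟨c, -, hG, rfl⟩ := hV
  refine ⟨c, ?_, rfl⟩
  by_contra hc
  rw [mem_union, not_or] at hc
  obtain ⟨H, hH⟩ := π.exists_lyapunov_linMatrix hG.ne'
    (π.evenOddResultant_charCoeff_ne_zero hc.1 hG.ne' hc.2)
  exact hnot (MTParams.uniformExponentialConvergence_of_lyapunov hVeq hH)
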